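/- Let $(\breve N,\breve g)$ be a semi-Riemannian manifold (a smooth, finite-dimensional, Hausdorff, second countable manifold with a smooth symmetric nondegenerate $(0,2)$-tensor field $\breve g$), with Levi-Civita connection $\breve\nabla$. Let $\breve P$ be a locally Golden structure on it: a smooth $(1,1)$-tensor field with $\breve P^2=\breve P+I$, $\breve g(\breve PX,Y)=\breve g(X,\breve PY)$ and $\breve\nabla_X(\breve PY)=\breve P\,\breve\nabla_XY$ for all vector fields $X,Y$. Let $\acute N$ be a smooth immersed submanifold of $\breve N$ which is lightlike: its radical distribution $\mathrm{Rad}\,T\acute N=T\acute N\cap T\acute N^{\perp}$ has constant rank $r\ge 1$. Let $S(T\acute N)$ be a screen distribution, $S(T\acute N^{\perp})$ a screen transversal bundle and $ltr(T\acute N)$ a transversal bundle, i.e. smooth vector subbundles of $T\breve N|_{\acute N}$ with $$T\acute N=\mathrm{Rad}\,T\acute N\perp S(T\acute N),\qquad T\acute N^{\perp}=\mathrm{Rad}\,T\acute N\perp S(T\acute N^{\perp}),$$ $$T\breve N|_{\acute N}=S(T\acute N)\perp\big[\mathrm{Rad}\,T\acute N\oplus ltr(T\acute N)\big]\perp S(T\acute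 N^{\perp}),$$ where $\perp$ denotes an orthogonal direct sum; $ltr(T\acute N)$ may be, but is not required to be, totally isotropic. Put $tr(T\acute N)=ltr(T\acute N)\perp S(T\acute N^{\perp})$. Let $\nabla$ be the induced connection, $\nabla_WU$ being the $T\acute N$-component of $\breve\nabla_WU$ in $T\breve N|_{\acute N}=T\acute N\oplus tr(T\acute N)$ for vector fields $W,U$ tangent to $\acute N$; and for $Z\in\Gamma(S(T\acute N))$ let $h^{*}(W,Z)$ be the $\mathrm{Rad}\,T\acute N$-component of $\nabla_WZ$ in $T\acute N=\mathrm{Rad}\,T\acute N\perp S(T\acute N)$. Suppose that $\acute N$ is radical transversal, i.e. $$\breve P(\mathrm{Rad}\,T\acute N)=ltr(T\acute N),\qquad \breve P(S(T\acute N))=S(T\acute N).$$ Then $\mathrm{Rad}\,T\acute N$ defines a totally geodesic foliation on $\acute N$ (that is, it is closed under the Lie bracket and $\nabla_WU\in\Gamma(\mathrm{Rad}\,T\acute N)$ for all $W,U\in\Gamma(\mathrm{Rad}\,T\acute N)$) if and only if $$h^{*}(W,\breve PZ)=h^{*}(W,Z)\qquad\text{for all } W\in\Gamma(\mathrm{Rad}\,T\acute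 N),\ Z\in\Gamma(S(T\acute N)).$$ -/

import Mathlib

open Bundle Manifold
open scoped ContDiff Topology

noncomputable section

namespace GoldenLightlike

/-! Ambient manifold `M`, modelled on the finite-dimensional space `E`; submanifold `N`, modelled on
`F`, with immersion `f : N → M`.  All bundles over `N` are subbundles of the restriction of `TM` to
`N`, that is families of subspaces of `TangentSpace 𝓘(ℝ, E) (f x)`, `x : N`. -/

variable {E : Type*} [NormedAddCommGroup E] [NormedSpace ℝ E]
  {M : Type*} [TopologicalSpace M] [ChartedSpace E M] [IsManifold 𝓘(ℝ, E) ∞ M]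
  {F : Type*} [NormedAddCommGroup F] [NormedSpace ℝ F]
  {N : Type*} [TopologicalSpace N] [ChartedSpace F N]

variable (E M) in
/-- A semi-Riemannian metric: a smooth field of symmetric nondegenerate bilinear forms. -/
structure SemiRiemannianMetric where
  inner (p : M) : TangentSpace 𝓘(ℝ, E) p →L[ℝ] TangentSpace 𝓘(ℝ, E) p →L[ℝ] ℝ
  symm (p : M) (v w : TangentSpace 𝓘(ℝ, E) p) : inner p v w = inner p w v
  nondegenerate (p : M) (v : TangentSpace 𝓘(ℝ, E) p) : (∀ w, inner p v w = 0) → v = 0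
  contMDiff : ContMDiff 𝓘(ℝ, E) (𝓘(ℝ, E).prod 𝓘(ℝ, E →L[ℝ] E →L[ℝ] ℝ)) ∞
    (fun p ↦ TotalSpace.mk' (E →L[ℝ] E →L[ℝ] ℝ) p (inner p))

/-- A Golden structure compatible with the metric `g`: a smooth `(1,1)`-tensor field `P` with
`P² = P + I` and `g (P v, w) = g (v, P w)`. -/
structure GoldenStructure (g : SemiRiemannianMetric E M) where
  P (p : M) : TangentSpace 𝓘(ℝ, E) p →L[ℝ] TangentSpace 𝓘(ℝ, E) p
  sq (p : M) (v : TangentSpace 𝓘(ℝ, E) p) : P p (P p v) = P p v + v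
  compatible (p : M) (v w : TangentSpace 𝓘(ℝ, E) p) :
    g.inner p (P p v) w = g.inner p v (P p w)
  contMDiff : ContMDiff 𝓘(ℝ, E) (𝓘(ℝ, E).prod 𝓘(ℝ, E →L[ℝ] E)) ∞
    (fun p ↦ TotalSpace.mk' (E →L[ℝ] E) p (P p))

/-- `cov` is the Levi-Civita connection of `g`: it is torsion-free and metric.
(In Mathlib's convention `cov Y p v` is `∇_v Y`.) -/
structure IsLeviCivita (g : SemiRiemannianMetric E M)
    (cov : CovariantDerivative 𝓘(ℝ, E) E (TangentSpace 𝓘(ℝ, E) : M → Type _)) : Prop where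
  torsion_free : ∀ (X Y : Π p : M, TangentSpace 𝓘(ℝ, E) p) (p : M),
    MDiffAt (T% X) p → MDiffAt (T% Y) p →
      cov Y p (X p) - cov X p (Y p) = VectorField.mlieBracket 𝓘(ℝ, E) X Y p
  metric : ∀ (X Y : Π p : M, TangentSpace 𝓘(ℝ, E) p) (p : M) (v : TangentSpace 𝓘(ℝ, E) p),
    MDiffAt (T% X) p → MDiffAt (T% Y) p →
      mvfderiv 𝓘(ℝ, E) (fun q ↦ g.inner q (X q) (Y q)) p v =
        g.inner p (cov X p v) (Y p) + g.inner p (X p) (cov Y p v)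

/-- The Golden structure is locally Golden: `P` is parallel, `∇_v (P X) = P (∇_v X)`. -/
def GoldenStructure.IsLocallyGolden {g : SemiRiemannianMetric E M} (P : GoldenStructure g)
    (cov : CovariantDerivative 𝓘(ℝ, E) E (TangentSpace 𝓘(ℝ, E) : M → Type _)) : Prop :=
  ∀ (X : Π p : M, TangentSpace 𝓘(ℝ, E) p) (p : M) (v : TangentSpace 𝓘(ℝ, E) p),
    MDiffAt (T% X) p → cov (fun q ↦ P.P q (X q)) p v = P.P p (cov X p v)

/-- Smoothness, on the set `s`, of a vector field `U` along `f` (a section of `TM|_N`). -/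
def SmoothAlongOn (f : N → M) (U : Π x : N, TangentSpace 𝓘(ℝ, E) (f x)) (s : Set N) : Prop :=
  ContMDiffOn 𝓘(ℝ, F) (𝓘(ℝ, E).prod 𝓘(ℝ, E)) ∞
    (fun x ↦ (⟨f x, U x⟩ : TotalSpace E (TangentSpace 𝓘(ℝ, E) : M → Type _))) s

/-- `D` is a smooth vector subbundle of `TM|_N`: it has smooth local frames. -/
def IsSmoothSubbundle (f : N → M) (D : Π x : N, Submodule ℝ (TangentSpace 𝓘(ℝ, E) (f x))) :
    Prop :=
  ∀ x₀ : N, ∃ s ∈ 𝓝 x₀, ∃ (k : ℕ) (b : Fin k → Π x : N, TangentSpace 𝓘(ℝ, E) (f x)),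
    (∀ i, SmoothAlongOn (F := F) f (b i) s) ∧
    ∀ x ∈ s, LinearIndependent ℝ (fun i ↦ b i x) ∧
      Submodule.span ℝ (Set.range fun i ↦ b i x) = D x

/-- `U ∈ Γ(D)`: a (global) smooth section of the family `D` of subspaces of `TM|_N`. -/
def IsSection (f : N → M) (D : Π x : N, Submodule ℝ (TangentSpace 𝓘(ℝ, E) (f x)))
    (U : Π x : N, TangentSpace 𝓘(ℝ, E) (f x)) : Prop :=
  SmoothAlongOn (F := F) f U Set.univ ∧ ∀ x, U x ∈ D x

/-- The vector field `df (X)` along `f` of a vector field `X` on `N`. -/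
def push (f : N → M) (X : Π x : N, TangentSpace 𝓘(ℝ, F) x) (x : N) :
    TangentSpace 𝓘(ℝ, E) (f x) :=
  mfderiv 𝓘(ℝ, F) 𝓘(ℝ, E) f x (X x)

/-- A smooth vector field `X` on `N` which, as a section of `TM|_N`, lies in `D`. -/
def IsTangentSection [IsManifold 𝓘(ℝ, F) ∞ N] (f : N → M) (D : Π x : N, Submodule ℝ (TangentSpace 𝓘(ℝ, E) (f x)))
    (X : Π x : N, TangentSpace 𝓘(ℝ, F) x) : Prop :=
  ContMDiff 𝓘(ℝ, F) (𝓘(ℝ, F).prod 𝓘(ℝ, F)) ∞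
    (fun x ↦ (⟨x, X x⟩ : TotalSpace F (TangentSpace 𝓘(ℝ, F) : N → Type _))) ∧
  ∀ x, push f X x ∈ D x

/-- The connection induced by `cov` on `TM|_N`: `covAlong cov f U x w` is the covariant derivative
at `x` of the field `U` along `f` in the direction `w ∈ T_x N`.  In the standard trivialization of
`TM` at `f x` with frame `e_i`, if `U = ∑ uⁱ e_i`, it is
`∑ (w uⁱ) e_i + ∑ uⁱ(x) ∇_{df w} e_i`. -/
def covAlong (cov : CovariantDerivative 𝓘(ℝ, E) E (TangentSpace 𝓘(ℝ, E) : M → Type _))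
    (f : N → M) (U : Π x : N, TangentSpace 𝓘(ℝ, E) (f x)) (x : N)
    (w : TangentSpace 𝓘(ℝ, F) x) : TangentSpace 𝓘(ℝ, E) (f x) :=
  let e := trivializationAt E (TangentSpace 𝓘(ℝ, E) : M → Type _) (f x)
  let u : N → E := fun y ↦ (e ⟨f y, U y⟩).2
  e.symm (f x) (mvfderiv 𝓘(ℝ, F) u x w) +
    cov (fun p ↦ e.symm p (u x)) (f x) (mfderiv 𝓘(ℝ, F) 𝓘(ℝ, E) f x w)

/-- The tangent space `T_x N`, as the subspace `df (T_x N)` of `T_{f x} M`. -/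
def tangent (f : N → M) (x : N) : Submodule ℝ (TangentSpace 𝓘(ℝ, E) (f x)) :=
  LinearMap.range (mfderiv 𝓘(ℝ, F) 𝓘(ℝ, E) f x).toLinearMap

/-- The orthogonal space of a subspace of `T_p M` with respect to `g`. -/
def SemiRiemannianMetric.perp (g : SemiRiemannianMetric E M) {p : M}
    (A : Submodule ℝ (TangentSpace 𝓘(ℝ, E) p)) : Submodule ℝ (TangentSpace 𝓘(ℝ, E) p) where
  carrier := {u | ∀ v ∈ A, g.inner p u v = 0}
  add_mem' ha hb v hv := by simp [ha v hv, hb v hv]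
  zero_mem' v _ := by simp
  smul_mem' c a ha v hv := by simp [ha v hv]

variable (F) in
/-- The radical distribution `Rad TN = TN ∩ TN^⊥`. -/
def radical (g : SemiRiemannianMetric E M) (f : N → M) (x : N) :
    Submodule ℝ (TangentSpace 𝓘(ℝ, E) (f x)) :=
  tangent (F := F) f x ⊓ g.perp (tangent (F := F) f x)

variable (F) in
/-- `N`, immersed in `M` by `f`, is an `r`-lightlike submanifold, `r ≥ 1`. -/
structure IsLightlikeSubmanifold (g : SemiRiemannianMetric E M) (f : N → M) (r : ℕ) : Prop where
  contMDiff : ContMDiff 𝓘(ℝ, F) 𝓘(ℝ, E) ∞ f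
  immersion : ∀ x, Function.Injective (mfderiv 𝓘(ℝ, F) 𝓘(ℝ, E) f x)
  one_le : 1 ≤ r
  rank_radical : ∀ x, Module.finrank ℝ (radical F g f x) = r

variable (F) in
/-- A choice of a screen distribution `S(TN)`, a screen transversal bundle `S(TN^⊥)` and a
transversal bundle `ltr(TN)` of a lightlike submanifold:
`TN = Rad TN ⊥ S(TN)`, `TN^⊥ = Rad TN ⊥ S(TN^⊥)` and
`TM|_N = S(TN) ⊥ [Rad TN ⊕ ltr(TN)] ⊥ S(TN^⊥)`.
The nondegeneracy of `S(TN)` and of `S(TN^⊥)`, their orthogonality to `Rad TN` and to each other,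
and the duality of `ltr(TN)` and `Rad TN` under `g` follow from the fields.  `ltr(TN)` is allowed
to be null (totally isotropic), but this is not required. -/
structure TransversalDecomposition (g : SemiRiemannianMetric E M) (f : N → M) where
  screen (x : N) : Submodule ℝ (TangentSpace 𝓘(ℝ, E) (f x))
  screenTr (x : N) : Submodule ℝ (TangentSpace 𝓘(ℝ, E) (f x))
  ltr (x : N) : Submodule ℝ (TangentSpace 𝓘(ℝ, E) (f x))
  screen_smooth : IsSmoothSubbundle (F := F) f screen
  screenTr_smooth : IsSmoothSubbundle (F := F) f screenTr
  ltr_smooth : IsSmoothSubbundle (F := F) f ltr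
  screen_sup (x : N) : radical F g f x ⊔ screen x = tangent (F := F) f x
  screen_disjoint (x : N) : Disjoint (radical F g f x) (screen x)
  screenTr_sup (x : N) : radical F g f x ⊔ screenTr x = g.perp (tangent (F := F) f x)
  screenTr_disjoint (x : N) : Disjoint (radical F g f x) (screenTr x)
  ltr_disjoint (x : N) : Disjoint (ltr x) (screenTr x)
  isCompl (x : N) : IsCompl (tangent (F := F) f x) (ltr x ⊔ screenTr x)
  ltr_perp_screen (x : N) : ltr x ≤ g.perp (screen x)
  ltr_perp_screenTr (x : N) : ltr x ≤ g.perp (screenTr x)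

namespace TransversalDecomposition

variable {g : SemiRiemannianMetric E M} {f : N → M} (D : TransversalDecomposition F g f)

/-- The transversal bundle `tr(TN) = ltr(TN) ⊥ S(TN^⊥)`. -/
def tr (x : N) : Submodule ℝ (TangentSpace 𝓘(ℝ, E) (f x)) := D.ltr x ⊔ D.screenTr x

theorem isCompl_radical (x : N) : IsCompl (radical F g f x) (D.screen x ⊔ D.tr x) := by
  have h1 := D.isCompl x
  have h2 := D.screen_sup x
  have h3 := D.screen_disjoint x
  refine ⟨?_, ?_⟩
  · rw [← h2] at h1
    exact h3.disjoint_sup_right_of_disjoint_sup_left h1.disjoint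
  · rw [codisjoint_iff, ← sup_assoc, h2]
    exact h1.sup_eq_top

/-- The induced connection `∇`: the tangential part of the ambient covariant derivative in the
Gauss formula `∇̄_W U = ∇_W U + h(W, U)`, along `tr(TN)`. -/
def inducedConnection (cov : CovariantDerivative 𝓘(ℝ, E) E (TangentSpace 𝓘(ℝ, E) : M → Type _))
    (W : Π x : N, TangentSpace 𝓘(ℝ, F) x) (U : Π x : N, TangentSpace 𝓘(ℝ, E) (f x)) (x : N) :
    TangentSpace 𝓘(ℝ, E) (f x) :=
  (tangent (F := F) f x).projection (D.tr x) (D.isCompl x) (covAlong cov f U x (W x))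

/-- `h*(W, Z)` for `Z ∈ Γ(S(TN))`: the component in `Rad TN` of `∇_W Z ∈ TN = Rad TN ⊥ S(TN)`, in
`∇_W Z = ∇*_W Z + h*(W, Z)`. -/
def hStar (cov : CovariantDerivative 𝓘(ℝ, E) E (TangentSpace 𝓘(ℝ, E) : M → Type _))
    (W : Π x : N, TangentSpace 𝓘(ℝ, F) x) (Z : Π x : N, TangentSpace 𝓘(ℝ, E) (f x)) (x : N) :
    TangentSpace 𝓘(ℝ, E) (f x) :=
  (radical F g f x).projection (D.screen x ⊔ D.tr x) (D.isCompl_radical x)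
    (D.inducedConnection cov W Z x)

/-- `N` is radical transversal: `P (Rad TN) = ltr(TN)` and `P (S(TN)) = S(TN)`. -/
structure IsRadicalTransversal (P : GoldenStructure g) : Prop where
  map_radical (x : N) : (radical F g f x).map (P.P (f x)).toLinearMap = D.ltr x
  map_screen (x : N) : (D.screen x).map (P.P (f x)).toLinearMap = D.screen x

/-- `Rad TN` defines a totally geodesic foliation on `N`: it is integrable (closed under the Lie
bracket of vector fields on `N`), and its leaves are totally geodesic in `N` with respect to the
induced connection `∇`, i.e. `∇_X Y ∈ Γ(Rad TN)` for all `X, Y ∈ Γ(Rad TN)`. -/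
def RadicalDefinesTotallyGeodesicFoliation [IsManifold 𝓘(ℝ, F) ∞ N]
    (cov : CovariantDerivative 𝓘(ℝ, E) E (TangentSpace 𝓘(ℝ, E) : M → Type _)) : Prop :=
  ∀ X Y : Π x : N, TangentSpace 𝓘(ℝ, F) x,
    IsTangentSection f (radical F g f) X → IsTangentSection f (radical F g f) Y →
      (∀ x, push f (VectorField.mlieBracket 𝓘(ℝ, F) X Y) x ∈ radical F g f x) ∧
      ∀ x, D.inducedConnection cov X (push f Y) x ∈ radical F g f x

end TransversalDecomposition

end GoldenLightlike

end

open GoldenLightlike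

/-! Write `∇̄` for the ambient connection along `f`. For `Z` in the screen and `W` radical, split `v
= ∇̄_W Z` as `r + s + (P r' + σ)` with `r, r'` radical, `s` in the screen and `σ` in `S(TN^⊥)`; this
uses `ltr(TN) = P(Rad TN)`. Since `P` preserves `S(TN)` and `S(TN^⊥)` and `P² = P + I`, `P v = r' +
P s + (P (r + r') + P σ)`. As `P` is parallel, `P v = ∇̄_W (P Z)`, so `h*(W, Z) = r` and `h*(W, P Z)
= r'`. Against radical vectors, `v` pairs as `P r'` and `P v` as `P (r + r')`, and the form `g(u, P
r)` is nondegenerate on `Rad TN`.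

For radical `Y`, differentiating `g(Y, Z) = 0` shows that `∇_W Y` is radical for all `W, Y` exactly
when every such `v` is orthogonal to `Rad TN`, i.e. `r' = 0`. If this holds for `Z` and `P Z`, then
`r' = 0` and `r + r' = 0`, so both values of `h*` vanish. Conversely, the equation for `Z` gives `r'
= r`, and for `P Z` it gives `r + r' = r'`; hence `r = r' = 0`. Closure under brackets follows from
torsion-freeness.

Two analytic supports are needed. The connection along `f` is metric, torsion-free and commutes with
`P` (`IsLeviCivita.mvfderiv_inner`, `IsLeviCivita.covAlong_push_sub`,
`GoldenStructure.IsLocallyGolden.covAlong`). Every screen or radical vector extends to a global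
section (`IsSmoothSubbundle.exists_isSection`, `exists_isTangentSection`). -/

noncomputable section

namespace GoldenLightlike

/-! ### The Lie bracket as a commutator of derivations -/

section LieBracket

variable {F : Type*} [NormedAddCommGroup F] [NormedSpace ℝ F]
  {N : Type*} [TopologicalSpace N] [ChartedSpace F N]
  {V : Type*} [NormedAddCommGroup V] [NormedSpace ℝ V]

theorem mvfderiv_comp_mfderiv {E : Type*} [NormedAddCommGroup E] [NormedSpace ℝ E]
    {M : Type*} [TopologicalSpace M] [ChartedSpace E M] {f : N → M} {x : N} {h : M → V}
    (hh : MDiffAt h (f x)) (hf : MDifferentiableAt 𝓘(ℝ, F) 𝓘(ℝ, E) f x)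
    (w : TangentSpace 𝓘(ℝ, F) x) :
    mvfderiv 𝓘(ℝ, F) (fun y ↦ h (f y)) x w =
      mvfderiv 𝓘(ℝ, E) h (f x) (mfderiv 𝓘(ℝ, F) 𝓘(ℝ, E) f x w) :=
  congrArg (fun L : F →L[ℝ] V ↦ L w) (mfderiv_comp x hh hf)

theorem mpullbackWithin_extChartAt_symm_apply [IsManifold 𝓘(ℝ, F) 1 N] {x y : N}
    (hy : y ∈ (extChartAt 𝓘(ℝ, F) x).source) (Y : Π x : N, TangentSpace 𝓘(ℝ, F) x) :
    VectorField.mpullbackWithin 𝓘(ℝ, F) 𝓘(ℝ, F) (extChartAt 𝓘(ℝ, F) x).symm Y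
        (Set.range 𝓘(ℝ, F)) (extChartAt 𝓘(ℝ, F) x y) =
      mfderiv 𝓘(ℝ, F) 𝓘(ℝ, F) (extChartAt 𝓘(ℝ, F) x) y (Y y) := by
  have hinv := isInvertible_mfderivWithin_extChartAt_symm
    ((extChartAt 𝓘(ℝ, F) x).map_source hy)
  rw [VectorField.mpullbackWithin_apply]
  have h := mfderivWithin_extChartAt_symm_comp_mfderiv_extChartAt' (I := 𝓘(ℝ, F)) hy
  have hl := (extChartAt 𝓘(ℝ, F) x).left_inv hy
  apply hinv.injective
  rw [hinv.self_apply_inverse]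
  refine Eq.trans ?_ (congrArg (fun L ↦ L (Y y)) h).symm
  rw [hl]; rfl

theorem mvfderiv_eq_fderiv_extChartAt [IsManifold 𝓘(ℝ, F) 1 N] {h : N → V} {x y : N}
    (hy : y ∈ (extChartAt 𝓘(ℝ, F) x).source) (hh : MDiffAt h y) (v : TangentSpace 𝓘(ℝ, F) y) :
    mvfderiv 𝓘(ℝ, F) h y v =
      fderiv ℝ (h ∘ (extChartAt 𝓘(ℝ, F) x).symm) (extChartAt 𝓘(ℝ, F) x y)
        (mfderiv 𝓘(ℝ, F) 𝓘(ℝ, F) (extChartAt 𝓘(ℝ, F) x) y v) := by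
  have hl := (extChartAt 𝓘(ℝ, F) x).left_inv hy
  have h1 : MDifferentiableAt 𝓘(ℝ, F) 𝓘(ℝ, F) (extChartAt 𝓘(ℝ, F) x).symm
      (extChartAt 𝓘(ℝ, F) x y) :=
    ((contMDiffOn_extChartAt_symm (n := 1) x).contMDiffAt
      ((isOpen_extChartAt_target x).mem_nhds
        ((extChartAt 𝓘(ℝ, F) x).map_source hy))).mdifferentiableAt one_ne_zero
  have h2 : MDifferentiableAt 𝓘(ℝ, F) 𝓘(ℝ, F) (extChartAt 𝓘(ℝ, F) x) y :=
    mdifferentiableAt_extChartAt (by simpa using hy)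
  have h3 : MDifferentiableAt 𝓘(ℝ, F) 𝓘(ℝ, V) (h ∘ (extChartAt 𝓘(ℝ, F) x).symm)
      (extChartAt 𝓘(ℝ, F) x y) :=
    MDifferentiableAt.comp _ (by rwa [hl]) h1
  rw [← mfderiv_eq_fderiv]
  refine Eq.trans ?_ (congrArg (fun L : F →L[ℝ] V ↦ L v) (mfderiv_comp y h3 h2))
  refine congrArg (fun L : F →L[ℝ] V ↦ L v)
    (Filter.EventuallyEq.mfderiv_eq (I := 𝓘(ℝ, F)) (I' := 𝓘(ℝ, V)) ?_)
  filter_upwards [extChartAt_source_mem_nhds' hy] with z hz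
  simp [(extChartAt 𝓘(ℝ, F) x).left_inv hz, -extChartAt]

theorem two_le_infty : (2 : WithTop ℕ∞) ≤ ∞ := ENat.LEInfty.out

theorem one_le_infty : (1 : WithTop ℕ∞) ≤ ∞ := ENat.LEInfty.out

/-- The Lie bracket acts on vector-valued functions as the commutator of derivations. -/
theorem mvfderiv_mlieBracket [CompleteSpace F] [IsManifold 𝓘(ℝ, F) ∞ N] {h : N → V} {x : N}
    (hh : ContMDiffAt 𝓘(ℝ, F) 𝓘(ℝ, V) ∞ h x) {X Y : Π x : N, TangentSpace 𝓘(ℝ, F) x}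
    (hX : MDiffAt (T% X) x) (hY : MDiffAt (T% Y) x) :
    mvfderiv 𝓘(ℝ, F) h x (VectorField.mlieBracket 𝓘(ℝ, F) X Y x) =
      mvfderiv 𝓘(ℝ, F) (fun y ↦ mvfderiv 𝓘(ℝ, F) h y (Y y)) x (X x) -
      mvfderiv 𝓘(ℝ, F) (fun y ↦ mvfderiv 𝓘(ℝ, F) h y (X y)) x (Y x) := by
  set φ := extChartAt 𝓘(ℝ, F) x with hφ
  set k := h ∘ φ.symm with hk
  have hxs : x ∈ φ.source := mem_extChartAt_source x
  have hk2 : ContDiffAt ℝ 2 k (φ x) := by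
    rw [← contMDiffAt_iff_contDiffAt]
    refine ContMDiffAt.comp _ ((by rw [φ.left_inv hxs]; exact hh.of_le two_le_infty))
      (((contMDiffOn_extChartAt_symm x).contMDiffAt
        ((isOpen_extChartAt_target x).mem_nhds (φ.map_source hxs))))
  have hhn : ∀ᶠ y in 𝓝 x, MDiffAt h y := by
    filter_upwards [((contMDiffAt_iff_contMDiffAt_nhds (n := 1) (by simp)).1
      (hh.of_le one_le_infty))] with y hy using hy.mdifferentiableAt one_ne_zero
  set pb : (Π x : N, TangentSpace 𝓘(ℝ, F) x) → F → F := fun Y ↦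
    VectorField.mpullbackWithin 𝓘(ℝ, F) 𝓘(ℝ, F) φ.symm Y (Set.range 𝓘(ℝ, F)) with hpb
  have pbd (Y : Π x : N, TangentSpace 𝓘(ℝ, F) x) (hY : MDiffAt (T% Y) x) :
      DifferentiableAt ℝ (pb Y) (φ x) := by
    have h1 : DifferentiableWithinAt ℝ (pb Y) (φ.symm ⁻¹' Set.univ ∩ Set.range 𝓘(ℝ, F)) (φ x) :=
      hY.mdifferentiableWithinAt.differentiableWithinAt_mpullbackWithin_vectorField
    rwa [Set.preimage_univ, Set.univ_inter, ModelWithCorners.range_eq_univ,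
      differentiableWithinAt_univ] at h1
  have key (Y : Π x : N, TangentSpace 𝓘(ℝ, F) x) :
      (fun y ↦ mvfderiv 𝓘(ℝ, F) h y (Y y)) =ᶠ[𝓝 x] (fun z ↦ fderiv ℝ k z (pb Y z)) ∘ φ := by
    filter_upwards [hhn, extChartAt_source_mem_nhds (I := 𝓘(ℝ, F)) x] with y hy hys
    exact (mvfderiv_eq_fderiv_extChartAt hys hy _).trans
      (congrArg (fderiv ℝ k (φ y)) (mpullbackWithin_extChartAt_symm_apply hys Y).symm)
  have hdk : DifferentiableAt ℝ (fderiv ℝ k) (φ x) :=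
    (hk2.fderiv_right (m := 1) (by norm_num)).differentiableAt one_ne_zero
  -- In the chart, `X (Y h) = D²k (X, Y) + Dk (DY · X)`; the first term is symmetric and cancels in
  -- the commutator.
  have key2 (X Y : Π x : N, TangentSpace 𝓘(ℝ, F) x) (hY : MDiffAt (T% Y) x) :
      mvfderiv 𝓘(ℝ, F) (fun y ↦ mvfderiv 𝓘(ℝ, F) h y (Y y)) x (X x) =
        fderiv ℝ (fderiv ℝ k) (φ x) (pb X (φ x)) (pb Y (φ x)) +
          fderiv ℝ k (φ x) (fderiv ℝ (pb Y) (φ x) (pb X (φ x))) := by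
    have hd : HasFDerivAt (fun z ↦ fderiv ℝ k z (pb Y z)) _ (φ x) :=
      hdk.hasFDerivAt.clm_apply (pbd Y hY).hasFDerivAt
    have h1 : mvfderiv 𝓘(ℝ, F) (fun y ↦ mvfderiv 𝓘(ℝ, F) h y (Y y)) x (X x) =
        mfderiv 𝓘(ℝ, F) 𝓘(ℝ, V) ((fun z ↦ fderiv ℝ k z (pb Y z)) ∘ φ) x (X x) :=
      congrArg (fun L : F →L[ℝ] V ↦ L (X x)) (key Y).mfderiv_eq
    have h2 := mfderiv_comp x hd.differentiableAt.mdifferentiableAt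
      (mdifferentiableAt_extChartAt (I := 𝓘(ℝ, F)) (mem_chart_source F x))
    rw [mfderiv_eq_fderiv, hd.fderiv] at h2
    refine (h1.trans (congrArg (fun L : F →L[ℝ] V ↦ L (X x)) h2)).trans ?_
    have h3 : pb X (φ x) = mfderiv 𝓘(ℝ, F) 𝓘(ℝ, F) φ x (X x) :=
      mpullbackWithin_extChartAt_symm_apply hxs X
    rw [h3]
    exact add_comm _ _
  have hsymm : fderiv ℝ (fderiv ℝ k) (φ x) (pb X (φ x)) (pb Y (φ x)) =
      fderiv ℝ (fderiv ℝ k) (φ x) (pb Y (φ x)) (pb X (φ x)) :=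
    hk2.isSymmSndFDerivAt (by simp) _ _
  rw [key2 X Y hY, key2 Y X hX, hsymm, add_sub_add_left_eq_sub, ← map_sub]
  refine (mvfderiv_eq_fderiv_extChartAt hxs hhn.self_of_nhds _).trans (congrArg _ ?_)
  -- The manifold bracket is the chart bracket pulled back by the chart, so the derivative of the
  -- chart undoes the pullback.
  rw [← VectorField.mlieBracketWithin_univ, VectorField.mlieBracketWithin_apply]
  refine Eq.trans (b := VectorField.lieBracketWithin ℝ (pb X) (pb Y)
    (φ.symm ⁻¹' Set.univ ∩ Set.range 𝓘(ℝ, F)) (φ x))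
    ((isInvertible_mfderiv_extChartAt hxs).self_apply_inverse _) ?_
  rw [Set.preimage_univ, Set.univ_inter, ModelWithCorners.range_eq_univ,
    VectorField.lieBracketWithin_univ]
  rfl

end LieBracket

/-! ### Coordinate frames and the connection form -/

section Coordinates

variable {E : Type*} [NormedAddCommGroup E] [NormedSpace ℝ E]
  {M : Type*} [TopologicalSpace M] [ChartedSpace E M] [IsManifold 𝓘(ℝ, E) ∞ M]

/-- The vector field with constant components `a` in the standard trivialization at `p₀`. -/
def coordField (p₀ : M) (a : E) (p : M) : TangentSpace 𝓘(ℝ, E) p :=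
  (trivializationAt E (TangentSpace 𝓘(ℝ, E) : M → Type _) p₀).symmL ℝ p a

/-- The components of a tangent vector at `p` in the standard trivialization at `p₀`. -/
def coords (p₀ p : M) : TangentSpace 𝓘(ℝ, E) p →L[ℝ] E :=
  (trivializationAt E (TangentSpace 𝓘(ℝ, E) : M → Type _) p₀).continuousLinearMapAt ℝ p

theorem mem_baseSet_iff {p₀ p : M} :
    p ∈ (trivializationAt E (TangentSpace 𝓘(ℝ, E) : M → Type _) p₀).baseSet ↔
      p ∈ (chartAt E p₀).source := by
  simp

theorem coordField_coords {p₀ p : M} (hp : p ∈ (chartAt E p₀).source)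
    (v : TangentSpace 𝓘(ℝ, E) p) : coordField p₀ (coords p₀ p v) p = v :=
  Trivialization.symmL_continuousLinearMapAt _ (mem_baseSet_iff.2 hp) v

theorem coords_coordField {p₀ p : M} (hp : p ∈ (chartAt E p₀).source) (a : E) :
    coords p₀ p (coordField p₀ a p) = a :=
  Trivialization.continuousLinearMapAt_symmL _ (mem_baseSet_iff.2 hp) a

theorem coords_apply {p₀ p : M} (hp : p ∈ (chartAt E p₀).source) (v : TangentSpace 𝓘(ℝ, E) p) :
    coords p₀ p v = (trivializationAt E (TangentSpace 𝓘(ℝ, E) : M → Type _) p₀ ⟨p, v⟩).2 := by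
  exact Trivialization.continuousLinearMapAt_apply_of_mem ℝ _ (mem_baseSet_iff.2 hp) v

theorem coords_eq_mfderiv {p₀ p : M} (hp : p ∈ (chartAt E p₀).source)
    (v : TangentSpace 𝓘(ℝ, E) p) :
    coords p₀ p v = mvfderiv 𝓘(ℝ, E) (extChartAt 𝓘(ℝ, E) p₀) p v :=
  congrArg (fun L : E →L[ℝ] E ↦ L v) (TangentBundle.continuousLinearMapAt_trivializationAt hp)

theorem coordField_add (p₀ : M) (a b : E) :
    coordField p₀ (a + b) = coordField p₀ a + coordField p₀ b := by
  funext p; exact map_add _ _ _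

theorem coordField_smul (p₀ : M) (c : ℝ) (a : E) :
    coordField p₀ (c • a) = c • coordField p₀ a := by
  funext p; exact map_smul _ _ _

theorem mdifferentiableAt_coordField (p₀ : M) (a : E) : MDiffAt (T% (coordField p₀ a)) p₀ := by
  rw [mdifferentiableAt_section]
  refine (mdifferentiableAt_const (c := a)).congr_of_eventuallyEq ?_
  filter_upwards [chart_source_mem_nhds E p₀] with p hp
  rw [← coords_apply hp, coords_coordField hp]

variable (cov : CovariantDerivative 𝓘(ℝ, E) E (TangentSpace 𝓘(ℝ, E) : M → Type _))

/-- The connection form at `p₀` in the standard trivialization at `p₀`. -/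
def connectionForm (p₀ : M) :
    E →ₗ[ℝ] (TangentSpace 𝓘(ℝ, E) p₀ →L[ℝ] TangentSpace 𝓘(ℝ, E) p₀) where
  toFun a := cov (coordField p₀ a) p₀
  map_add' a b := by
    rw [coordField_add]
    exact cov.isCovariantDerivativeOnUniv.add (mdifferentiableAt_coordField p₀ a)
      (mdifferentiableAt_coordField p₀ b)
  map_smul' c a := by
    rw [coordField_smul]
    exact cov.isCovariantDerivativeOnUniv.smul_const c (mdifferentiableAt_coordField p₀ a)

end Coordinates

/-! ### Calculus of vector fields along a map -/

section FieldsAlong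

variable {E : Type*} [NormedAddCommGroup E] [NormedSpace ℝ E]
  {M : Type*} [TopologicalSpace M] [ChartedSpace E M] [IsManifold 𝓘(ℝ, E) ∞ M]
  {F : Type*} [NormedAddCommGroup F] [NormedSpace ℝ F]
  {N : Type*} [TopologicalSpace N] [ChartedSpace F N]

/-- Differentiability at `x` of a vector field `U` along `f`. -/
def DifferentiableAlongAt (f : N → M) (U : Π x : N, TangentSpace 𝓘(ℝ, E) (f x)) (x : N) : Prop :=
  MDifferentiableAt 𝓘(ℝ, F) (𝓘(ℝ, E).prod 𝓘(ℝ, E))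
    (fun y ↦ (⟨f y, U y⟩ : TotalSpace E (TangentSpace 𝓘(ℝ, E) : M → Type _))) x

theorem SmoothAlongOn.differentiableAlongAt {f : N → M} {U : Π x : N, TangentSpace 𝓘(ℝ, E) (f x)}
    (hU : SmoothAlongOn (F := F) f U Set.univ) (x : N) : DifferentiableAlongAt (F := F) f U x :=
  (hU.contMDiffAt Filter.univ_mem).mdifferentiableAt (by simp)

variable {f : N → M} {U V : Π x : N, TangentSpace 𝓘(ℝ, E) (f x)} {x : N}

theorem DifferentiableAlongAt.base (hU : DifferentiableAlongAt (F := F) f U x) :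
    MDifferentiableAt 𝓘(ℝ, F) 𝓘(ℝ, E) f x :=
  ((mdifferentiableAt_totalSpace _ _).1 hU).1

theorem DifferentiableAlongAt.eventually_mem
    (hU : DifferentiableAlongAt (F := F) f U x) :
    ∀ᶠ y in 𝓝 x, f y ∈ (chartAt E (f x)).source :=
  hU.base.continuousAt.eventually (chart_source_mem_nhds E (f x))

theorem DifferentiableAlongAt.coords (hU : DifferentiableAlongAt (F := F) f U x) :
    MDifferentiableAt 𝓘(ℝ, F) 𝓘(ℝ, E) (fun y ↦ coords (f x) (f y) (U y)) x := by
  refine ((mdifferentiableAt_totalSpace _ _).1 hU).2.congr_of_eventuallyEq ?_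
  filter_upwards [hU.eventually_mem] with y hy
  rw [coords_apply hy]

theorem differentiableAlongAt_comp {X : Π p : M, TangentSpace 𝓘(ℝ, E) p}
    (hX : MDiffAt (T% X) (f x)) (hf : MDifferentiableAt 𝓘(ℝ, F) 𝓘(ℝ, E) f x) :
    DifferentiableAlongAt (F := F) f (fun y ↦ X (f y)) x :=
  MDifferentiableAt.comp x hX hf

theorem SemiRiemannianMetric.mdifferentiableAt_inner (g : SemiRiemannianMetric E M)
    (hU : DifferentiableAlongAt (F := F) f U x) (hV : DifferentiableAlongAt (F := F) f V x) :
    MDifferentiableAt 𝓘(ℝ, F) 𝓘(ℝ) (fun y ↦ g.inner (f y) (U y) (V y)) x := by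
  -- A scalar function is treated as a section of the trivial line bundle, so that the rule for
  -- applying bundle maps to sections applies.
  have : MDifferentiableAt 𝓘(ℝ, F) (𝓘(ℝ, E).prod 𝓘(ℝ))
      (fun y ↦ TotalSpace.mk' ℝ (E := Bundle.Trivial M ℝ) (f y) (g.inner (f y) (U y) (V y))) x := by
    apply MDifferentiableAt.clm_bundle_apply₂ (F₁ := E) (F₂ := E)
    · exact MDifferentiableAt.comp x ((g.contMDiff _).mdifferentiableAt (by simp)) hU.base
    · exact hU
    · exact hV
  exact ((mdifferentiableAt_totalSpace _ _).1 this).2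

theorem GoldenStructure.differentiableAlongAt {g : SemiRiemannianMetric E M}
    (P : GoldenStructure g) (hU : DifferentiableAlongAt (F := F) f U x) :
    DifferentiableAlongAt (F := F) f (fun y ↦ P.P (f y) (U y)) x := by
  apply MDifferentiableAt.clm_bundle_apply (F₁ := E) (F₂ := E)
  · exact MDifferentiableAt.comp x ((P.contMDiff _).mdifferentiableAt (by simp)) hU.base
  · exact hU

theorem GoldenStructure.smoothAlongOn {g : SemiRiemannianMetric E M}
    (P : GoldenStructure g) {s : Set N} (hf : ContMDiffOn 𝓘(ℝ, F) 𝓘(ℝ, E) ∞ f s)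
    (hU : SmoothAlongOn (F := F) f U s) :
    SmoothAlongOn (F := F) f (fun y ↦ P.P (f y) (U y)) s := by
  apply ContMDiffOn.clm_bundle_apply (F₁ := E) (F₂ := E)
  · exact P.contMDiff.comp_contMDiffOn hf
  · exact hU

theorem SemiRiemannianMetric.inner_coordField_sum (g : SemiRiemannianMetric E M) {p₀ : M} (p : M) (a : E) {ι : Type*} [Fintype ι]
    (b : Module.Basis ι ℝ E) (v : TangentSpace 𝓘(ℝ, E) p) :
    g.inner p (coordField p₀ a p) v = ∑ i, b.repr a i * g.inner p (coordField p₀ (b i) p) v := by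
  conv_lhs => rw [← b.sum_repr a]
  simp only [coordField, map_sum, map_smul, sum_apply, smul_apply, smul_eq_mul]

variable (cov : CovariantDerivative 𝓘(ℝ, E) E (TangentSpace 𝓘(ℝ, E) : M → Type _))

/-- The raw trivialization maps in `covAlong` agree with the linear maps `coords` and `coordField`
near `f x`; derivatives and `cov` only see germs. The result is linear in the components of `U x`.
-/
theorem covAlong_eq (hU : DifferentiableAlongAt (F := F) f U x) (w : TangentSpace 𝓘(ℝ, F) x) :
    covAlong cov f U x w =
      coordField (f x) (mvfderiv 𝓘(ℝ, F) (fun y ↦ coords (f x) (f y) (U y)) x w) (f x) +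
        connectionForm cov (f x) (coords (f x) (f x) (U x))
          (mfderiv 𝓘(ℝ, F) 𝓘(ℝ, E) f x w) := by
  have hx : f x ∈ (chartAt E (f x)).source := mem_chart_source E (f x)
  have h1 : (fun y ↦ (trivializationAt E (TangentSpace 𝓘(ℝ, E) : M → Type _) (f x)
      ⟨f y, U y⟩).2) =ᶠ[𝓝 x] fun y ↦ coords (f x) (f y) (U y) := by
    filter_upwards [hU.eventually_mem] with y hy
    rw [coords_apply hy]
  have h2 (a : E) : ∀ᶠ p in 𝓝 (f x), coordField (f x) a p =
      (trivializationAt E (TangentSpace 𝓘(ℝ, E) : M → Type _) (f x)).symm p a := by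
    filter_upwards [chart_source_mem_nhds E (f x)] with p hp
    exact Trivialization.symmL_apply _ (mem_baseSet_iff.2 hp) a
  have h3 (a : E) : cov (fun p ↦ (trivializationAt E (TangentSpace 𝓘(ℝ, E) : M → Type _)
      (f x)).symm p a) (f x) = cov (coordField (f x) a) (f x) := by
    have hd := mdifferentiableAt_coordField (f x) a
    refine (cov.isCovariantDerivativeOnUniv.congr_of_eventuallyEq hd ?_ Filter.univ_mem
      (h2 a)).symm
    refine hd.congr_of_eventuallyEq ?_
    filter_upwards [h2 a] with p hp
    rw [hp]
  rw [covAlong]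
  simp only
  rw [h3, ← (h2 _).self_of_nhds, ← coords_apply hx]
  refine congrArg₂ _ (congrArg (coordField (f x) · (f x)) ?_) rfl
  exact congrArg (fun L : F →L[ℝ] E ↦ L w) h1.mfderiv_eq

variable [FiniteDimensional ℝ E]

theorem mvfderiv_sum_coord_mul {ι : Type} [Fintype ι] (b : Module.Basis ι ℝ E) {u : N → E}
    {γ : ι → N → ℝ} (hu : MDifferentiableAt 𝓘(ℝ, F) 𝓘(ℝ, E) u x)
    (hγ : ∀ i, MDifferentiableAt 𝓘(ℝ, F) 𝓘(ℝ) (γ i) x) (w : TangentSpace 𝓘(ℝ, F) x) :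
    mvfderiv 𝓘(ℝ, F) (fun y ↦ ∑ i, b.repr (u y) i * γ i y) x w =
      ∑ i, (b.repr (mvfderiv 𝓘(ℝ, F) u x w) i * γ i x +
        b.repr (u x) i * mvfderiv 𝓘(ℝ, F) (γ i) x w) := by
  let c (i) : E →L[ℝ] ℝ := LinearMap.toContinuousLinearMap (b.coord i)
  have hc (i) : HasMFDerivAt 𝓘(ℝ, F) 𝓘(ℝ) (fun y ↦ c i (u y)) x
      ((c i).comp (mvfderiv 𝓘(ℝ, F) u x)) :=
    HasMFDerivAt.comp x (c i).hasMFDerivAt hu.hasMFDerivAt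
  have hm (i) : HasMFDerivAt 𝓘(ℝ, F) 𝓘(ℝ) ((fun y ↦ c i (u y)) * γ i) x
      (c i (u x) • mvfderiv 𝓘(ℝ, F) (γ i) x + γ i x • (c i).comp (mvfderiv 𝓘(ℝ, F) u x)) :=
    (hc i).mul (hγ i).hasMFDerivAt
  have h := HasMFDerivAt.sum (I := 𝓘(ℝ, F)) (t := Finset.univ)
    (f := fun i ↦ (fun y ↦ c i (u y)) * γ i)
    (f' := fun i ↦ c i (u x) • mvfderiv 𝓘(ℝ, F) (γ i) x +
      γ i x • (c i).comp (mvfderiv 𝓘(ℝ, F) u x)) fun i _ ↦ hm i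
  have h1 : (fun y ↦ ∑ i, b.repr (u y) i * γ i y) =
      ∑ i, ((fun y ↦ c i (u y)) * γ i) := by
    funext y; simp [c]
  rw [h1]
  refine (congrArg (fun L : F →L[ℝ] ℝ ↦ L w) h.mfderiv).trans ?_
  have hs (φ : ι → F →L[ℝ] ℝ) (v : F) : (∑ i, φ i) v = ∑ i, φ i v := by simp
  refine (hs _ _).trans (Finset.sum_congr rfl fun i _ ↦ ?_)
  refine (add_comm _ _).trans (congrArg₂ _ (mul_comm _ _) rfl)

variable {cov} {g : SemiRiemannianMetric E M}

/-- Half of the metric property along `f`: one field is the restriction of an ambient field.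
Expanding `U` in the coordinate frame reduces it to the ambient identity for pairs of ambient
fields. The general case `IsLeviCivita.mvfderiv_inner` repeats the expansion in the other slot. -/
theorem IsLeviCivita.mvfderiv_inner_comp (hcov : IsLeviCivita g cov)
    (hU : DifferentiableAlongAt (F := F) f U x) {X : Π p : M, TangentSpace 𝓘(ℝ, E) p}
    (hX : MDiffAt (T% X) (f x)) (w : TangentSpace 𝓘(ℝ, F) x) :
    mvfderiv 𝓘(ℝ, F) (fun y ↦ g.inner (f y) (U y) (X (f y))) x w =
      g.inner (f x) (covAlong cov f U x w) (X (f x)) +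
        g.inner (f x) (U x) (cov X (f x) (mfderiv 𝓘(ℝ, F) 𝓘(ℝ, E) f x w)) := by
  set b := Module.finBasis ℝ E
  have hx : f x ∈ (chartAt E (f x)).source := mem_chart_source E (f x)
  have hE (i) := mdifferentiableAt_coordField (f x) (b i)
  have h1 : (fun y ↦ g.inner (f y) (U y) (X (f y))) =ᶠ[𝓝 x] fun y ↦
      ∑ i, b.repr (coords (f x) (f y) (U y)) i *
        g.inner (f y) (coordField (f x) (b i) (f y)) (X (f y)) := by
    filter_upwards [hU.eventually_mem] with y hy
    rw [← g.inner_coordField_sum, coordField_coords hy]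
  have hγ (i) : MDifferentiableAt 𝓘(ℝ, F) 𝓘(ℝ)
      (fun y ↦ g.inner (f y) (coordField (f x) (b i) (f y)) (X (f y))) x :=
    g.mdifferentiableAt_inner (differentiableAlongAt_comp (hE i) hU.base)
      (differentiableAlongAt_comp hX hU.base)
  have hγ' (i) : mvfderiv 𝓘(ℝ, F)
      (fun y ↦ g.inner (f y) (coordField (f x) (b i) (f y)) (X (f y))) x w = _ :=
    (mvfderiv_comp_mfderiv (h := fun p ↦ g.inner p (coordField (f x) (b i) p) (X p))
      (g.mdifferentiableAt_inner (f := id) (hE i) hX) hU.base w).trans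
      (hcov.metric _ _ _ _ (hE i) hX)
  refine (congrArg (fun L : F →L[ℝ] ℝ ↦ L w) h1.mfderiv_eq).trans ?_
  refine (mvfderiv_sum_coord_mul b hU.coords hγ w).trans ?_
  simp only [hγ', Finset.sum_add_distrib, mul_add]
  rw [← g.inner_coordField_sum, ← g.inner_coordField_sum, coordField_coords hx, covAlong_eq cov hU,
    map_add, add_apply, add_assoc]
  congr 2
  conv_rhs => rw [← b.sum_repr (coords (f x) (f x) (U x))]
  simp only [map_sum, map_smul, sum_apply, smul_apply, smul_eq_mul]
  rfl

theorem IsLeviCivita.mvfderiv_inner (hcov : IsLeviCivita g cov)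
    (hU : DifferentiableAlongAt (F := F) f U x) (hV : DifferentiableAlongAt (F := F) f V x)
    (w : TangentSpace 𝓘(ℝ, F) x) :
    mvfderiv 𝓘(ℝ, F) (fun y ↦ g.inner (f y) (U y) (V y)) x w =
      g.inner (f x) (covAlong cov f U x w) (V x) + g.inner (f x) (U x) (covAlong cov f V x w) := by
  set b := Module.finBasis ℝ E
  have hx : f x ∈ (chartAt E (f x)).source := mem_chart_source E (f x)
  have hE (i) := mdifferentiableAt_coordField (f x) (b i)
  have h1 : (fun y ↦ g.inner (f y) (U y) (V y)) =ᶠ[𝓝 x] fun y ↦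
      ∑ i, b.repr (coords (f x) (f y) (V y)) i *
        g.inner (f y) (U y) (coordField (f x) (b i) (f y)) := by
    filter_upwards [hU.eventually_mem] with y hy
    simp only [g.symm (f y) (U y)]
    rw [← g.inner_coordField_sum, coordField_coords hy]
  have hγ (i) : MDifferentiableAt 𝓘(ℝ, F) 𝓘(ℝ)
      (fun y ↦ g.inner (f y) (U y) (coordField (f x) (b i) (f y))) x :=
    g.mdifferentiableAt_inner hU (differentiableAlongAt_comp (hE i) hU.base)
  refine (congrArg (fun L : F →L[ℝ] ℝ ↦ L w) h1.mfderiv_eq).trans ?_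
  refine (mvfderiv_sum_coord_mul b hV.coords hγ w).trans ?_
  simp only [hcov.mvfderiv_inner_comp hU (hE _), g.symm (f x) (U x),
    g.symm (f x) (covAlong cov f U x w), Finset.sum_add_distrib, mul_add]
  rw [← g.inner_coordField_sum, ← g.inner_coordField_sum, coordField_coords hx, covAlong_eq cov hV,
    map_add, add_apply, add_left_comm]
  congr 2
  conv_rhs => rw [← b.sum_repr (coords (f x) (f x) (V x))]
  simp only [map_sum, map_smul, sum_apply, smul_apply, smul_eq_mul]
  rfl

/-- A parallel Golden structure is parallel along every map. -/
theorem GoldenStructure.IsLocallyGolden.covAlong {P : GoldenStructure g}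
    (hP : P.IsLocallyGolden cov) (hcov : IsLeviCivita g cov)
    (hU : DifferentiableAlongAt (F := F) f U x) (w : TangentSpace 𝓘(ℝ, F) x) :
    covAlong cov f (fun y ↦ P.P (f y) (U y)) x w = P.P (f x) (covAlong cov f U x w) := by
  have hx : f x ∈ (chartAt E (f x)).source := mem_chart_source E (f x)
  -- Nondegeneracy allows testing against one vector `v`, extended to an ambient field `X`.
  -- Differentiating `g(P U, X) = g(U, P X)` on both sides then leaves only the wanted terms.
  refine sub_eq_zero.1 (g.nondegenerate _ _ fun v ↦ ?_)
  set X := coordField (f x) (coords (f x) (f x) v) with hX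
  have hXv : X (f x) = v := coordField_coords hx v
  have hXd : MDiffAt (T% X) (f x) := mdifferentiableAt_coordField _ _
  have hPX : MDiffAt (T% (fun p ↦ P.P p (X p))) (f x) :=
    P.differentiableAlongAt (f := id) hXd
  have h1 := hcov.mvfderiv_inner_comp (P.differentiableAlongAt hU) hXd w
  have h2 := hcov.mvfderiv_inner_comp hU hPX w
  simp only [P.compatible] at h1
  rw [h2, hP X _ _ hXd, hXv, ← P.compatible] at h1
  rw [map_sub, sub_apply, sub_eq_zero]
  linarith

end FieldsAlong

/-! ### Torsion-freeness along the immersion -/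

section Torsion

variable {E : Type*} [NormedAddCommGroup E] [NormedSpace ℝ E]
  {M : Type*} [TopologicalSpace M] [ChartedSpace E M] [IsManifold 𝓘(ℝ, E) ∞ M]
  {F : Type*} [NormedAddCommGroup F] [NormedSpace ℝ F]
  {N : Type*} [TopologicalSpace N] [ChartedSpace F N]

variable {f : N → M} [IsManifold 𝓘(ℝ, F) ∞ N]

theorem smoothAlongOn_push (hf : ContMDiff 𝓘(ℝ, F) 𝓘(ℝ, E) ∞ f)
    {X : Π x : N, TangentSpace 𝓘(ℝ, F) x}
    (hX : ContMDiff 𝓘(ℝ, F) (𝓘(ℝ, F).prod 𝓘(ℝ, F)) ∞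
      (fun x ↦ (⟨x, X x⟩ : TotalSpace F (TangentSpace 𝓘(ℝ, F) : N → Type _)))) :
    SmoothAlongOn (E := E) (F := F) f (push f X) Set.univ :=
  ((hf.contMDiff_tangentMap (m := ∞) le_rfl).comp hX).contMDiffOn

variable [FiniteDimensional ℝ E]

/-- Coordinate fields differentiate the chart to constants, so their commutator kills the chart,
whose derivative is injective. -/
theorem mlieBracket_coordField (p₀ : M) (a b : E) :
    VectorField.mlieBracket 𝓘(ℝ, E) (coordField p₀ a) (coordField p₀ b) p₀ = 0 := by
  have hp₀ : p₀ ∈ (chartAt E p₀).source := mem_chart_source E p₀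
  have h1 (a c : E) (v : TangentSpace 𝓘(ℝ, E) p₀) :
      mvfderiv 𝓘(ℝ, E) (fun p ↦ mvfderiv 𝓘(ℝ, E) (extChartAt 𝓘(ℝ, E) p₀) p (coordField p₀ a p))
        p₀ v = 0 := by
    have h2 : (fun p ↦ mvfderiv 𝓘(ℝ, E) (extChartAt 𝓘(ℝ, E) p₀) p (coordField p₀ a p)) =ᶠ[𝓝 p₀]
        fun _ ↦ a := by
      filter_upwards [chart_source_mem_nhds E p₀] with p hp
      rw [← coords_eq_mfderiv hp, coords_coordField hp]
    exact (congrArg (fun L : E →L[ℝ] E ↦ L v) (h2.mfderiv_eq.trans mfderiv_const)).trans rfl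
  have h3 := mvfderiv_mlieBracket (contMDiffAt_extChartAt (I := 𝓘(ℝ, E)) (n := ∞) (x := p₀))
    (mdifferentiableAt_coordField p₀ a) (mdifferentiableAt_coordField p₀ b)
  rw [h1 _ 0, h1 _ 0, sub_zero, ← coords_eq_mfderiv hp₀] at h3
  rw [← coordField_coords hp₀ (VectorField.mlieBracket _ _ _ p₀), h3]
  exact map_zero _

/-- The connection along `f` induced by a torsion-free connection is torsion-free. -/
theorem IsLeviCivita.covAlong_push_sub [CompleteSpace F] {g : SemiRiemannianMetric E M}
    {cov : CovariantDerivative 𝓘(ℝ, E) E (TangentSpace 𝓘(ℝ, E) : M → Type _)}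
    (hcov : IsLeviCivita g cov) (hf : ContMDiff 𝓘(ℝ, F) 𝓘(ℝ, E) ∞ f)
    {X Y : Π x : N, TangentSpace 𝓘(ℝ, F) x}
    (hX : ContMDiff 𝓘(ℝ, F) (𝓘(ℝ, F).prod 𝓘(ℝ, F)) ∞
      (fun x ↦ (⟨x, X x⟩ : TotalSpace F (TangentSpace 𝓘(ℝ, F) : N → Type _))))
    (hY : ContMDiff 𝓘(ℝ, F) (𝓘(ℝ, F).prod 𝓘(ℝ, F)) ∞
      (fun x ↦ (⟨x, Y x⟩ : TotalSpace F (TangentSpace 𝓘(ℝ, F) : N → Type _)))) (x : N) :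
    covAlong cov f (push f Y) x (X x) - covAlong cov f (push f X) x (Y x) =
      push f (VectorField.mlieBracket 𝓘(ℝ, F) X Y) x := by
  have hfx : f x ∈ (chartAt E (f x)).source := mem_chart_source E (f x)
  set ψ := extChartAt 𝓘(ℝ, E) (f x) with hψ
  -- In coordinates `df Z` is the derivative of `h` along `Z`, so the non-connection terms form the
  -- commutator of `X` and `Y` on `h`.
  set h : N → E := fun y ↦ ψ (f y) with hh
  have hfd (y : N) : MDifferentiableAt 𝓘(ℝ, F) 𝓘(ℝ, E) f y := (hf y).mdifferentiableAt (by simp)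
  have hψd {y : N} (hy : f y ∈ (chartAt E (f x)).source) : MDiffAt ψ (f y) :=
    mdifferentiableAt_extChartAt hy
  have hhs : ContMDiffAt 𝓘(ℝ, F) 𝓘(ℝ, E) ∞ h x := contMDiffAt_extChartAt.comp x (hf x)
  have hpush {y : N} (hy : f y ∈ (chartAt E (f x)).source) (Z : Π x : N, TangentSpace 𝓘(ℝ, F) x) :
      coords (f x) (f y) (push f Z y) = mvfderiv 𝓘(ℝ, F) h y (Z y) := by
    rw [coords_eq_mfderiv hy, push, hh, mvfderiv_comp_mfderiv (hψd hy) (hfd y)]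
  have hev {Z : Π x : N, TangentSpace 𝓘(ℝ, F) x} :
      (fun y ↦ coords (f x) (f y) (push f Z y)) =ᶠ[𝓝 x] fun y ↦ mvfderiv 𝓘(ℝ, F) h y (Z y) := by
    filter_upwards [(hf x).continuousAt.eventually (chart_source_mem_nhds E (f x))] with y hy
    exact hpush hy Z
  have hder (Z : Π x : N, TangentSpace 𝓘(ℝ, F) x) (w : TangentSpace 𝓘(ℝ, F) x) :
      mvfderiv 𝓘(ℝ, F) (fun y ↦ coords (f x) (f y) (push f Z y)) x w =
        mvfderiv 𝓘(ℝ, F) (fun y ↦ mvfderiv 𝓘(ℝ, F) h y (Z y)) x w :=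
    congrArg (fun L : F →L[ℝ] E ↦ L w) hev.mfderiv_eq
  -- Symmetry of the Christoffel symbols, which makes the connection terms cancel.
  have htor (u v : TangentSpace 𝓘(ℝ, E) (f x)) :
      connectionForm cov (f x) (coords (f x) (f x) u) v =
        connectionForm cov (f x) (coords (f x) (f x) v) u := by
    have := hcov.torsion_free _ _ _ (mdifferentiableAt_coordField (f x) (coords (f x) (f x) v))
      (mdifferentiableAt_coordField (f x) (coords (f x) (f x) u))
    rw [mlieBracket_coordField, coordField_coords hfx, coordField_coords hfx, sub_eq_zero] at this
    exact this
  rw [covAlong_eq cov ((smoothAlongOn_push hf hY).differentiableAlongAt x),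
    covAlong_eq cov ((smoothAlongOn_push hf hX).differentiableAlongAt x), hder, hder,
    htor (push f Y x)]
  refine (add_sub_add_right_eq_sub _ _ _).trans ?_
  rw [← coordField_coords hfx (push f (VectorField.mlieBracket 𝓘(ℝ, F) X Y) x), hpush hfx,
    mvfderiv_mlieBracket hhs ((hX x).mdifferentiableAt (by simp))
      ((hY x).mdifferentiableAt (by simp))]
  exact (map_sub _ _ _).symm

end Torsion

/-! ### Extending vectors to global smooth sections -/

section Extension

variable {E : Type*} [NormedAddCommGroup E] [NormedSpace ℝ E]
  {M : Type*} [TopologicalSpace M] [ChartedSpace E M] [IsManifold 𝓘(ℝ, E) ∞ M]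
  {F : Type*} [NormedAddCommGroup F] [NormedSpace ℝ F]
  {N : Type*} [TopologicalSpace N] [ChartedSpace F N]
  {f : N → M} {s : Set N}

theorem smoothAlongOn_iff (hf : ContMDiff 𝓘(ℝ, F) 𝓘(ℝ, E) ∞ f)
    {U : Π x : N, TangentSpace 𝓘(ℝ, E) (f x)} :
    SmoothAlongOn (F := F) f U s ↔ ∀ x ∈ s, ContMDiffWithinAt 𝓘(ℝ, F) 𝓘(ℝ, E) ∞
      (fun y ↦ coords (f x) (f y) (U y)) s x := by
  refine forall₂_congr fun x _ ↦ contMDiffWithinAt_totalSpace.trans ?_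
  have h : (fun y ↦ coords (f x) (f y) (U y)) =ᶠ[𝓝 x]
      fun y ↦ (trivializationAt E (TangentSpace 𝓘(ℝ, E) : M → Type _) (f x) ⟨f y, U y⟩).2 := by
    filter_upwards [(hf x).continuousAt.eventually (chart_source_mem_nhds E (f x))] with y hy
    rw [coords_apply hy]
  rw [(h.filter_mono nhdsWithin_le_nhds).contMDiffWithinAt_iff h.self_of_nhds]
  exact and_iff_right (hf x).contMDiffWithinAt

theorem SmoothAlongOn.smul (hf : ContMDiff 𝓘(ℝ, F) 𝓘(ℝ, E) ∞ f) {c : N → ℝ}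
    {U : Π x : N, TangentSpace 𝓘(ℝ, E) (f x)} (hc : ContMDiffOn 𝓘(ℝ, F) 𝓘(ℝ) ∞ c s)
    (hU : SmoothAlongOn (F := F) f U s) : SmoothAlongOn (F := F) f (fun y ↦ c y • U y) s := by
  rw [smoothAlongOn_iff hf] at hU ⊢
  intro x hx
  simp only [map_smul]
  exact (hc x hx).smul (hU x hx)

theorem SmoothAlongOn.add (hf : ContMDiff 𝓘(ℝ, F) 𝓘(ℝ, E) ∞ f)
    {U V : Π x : N, TangentSpace 𝓘(ℝ, E) (f x)} (hU : SmoothAlongOn (F := F) f U s)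
    (hV : SmoothAlongOn (F := F) f V s) : SmoothAlongOn (F := F) f (fun y ↦ U y + V y) s := by
  rw [smoothAlongOn_iff hf] at hU hV ⊢
  intro x hx
  simp only [map_add]
  exact (hU x hx).add (hV x hx)

theorem smoothAlongOn_zero (hf : ContMDiff 𝓘(ℝ, F) 𝓘(ℝ, E) ∞ f) :
    SmoothAlongOn (E := E) (F := F) f (fun _ ↦ 0) s := by
  rw [smoothAlongOn_iff hf]
  intro x hx
  simp only [map_zero]
  exact contMDiffWithinAt_const

theorem SmoothAlongOn.sum (hf : ContMDiff 𝓘(ℝ, F) 𝓘(ℝ, E) ∞ f) {ι : Type*} (t : Finset ι)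
    {U : ι → Π x : N, TangentSpace 𝓘(ℝ, E) (f x)}
    (hU : ∀ i ∈ t, SmoothAlongOn (F := F) f (U i) s) :
    SmoothAlongOn (F := F) f (fun y ↦ ∑ i ∈ t, U i y) s := by
  classical
  induction t using Finset.induction_on with
  | empty => simpa using smoothAlongOn_zero hf
  | insert i t hi ih =>
    simp only [Finset.sum_insert hi]
    exact (hU i (Finset.mem_insert_self i t)).add hf
      (ih fun j hj ↦ hU j (Finset.mem_insert_of_mem hj))

theorem IsSmoothSubbundle.exists_smoothAlongOn (hf : ContMDiff 𝓘(ℝ, F) 𝓘(ℝ, E) ∞ f)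
    {D : Π x : N, Submodule ℝ (TangentSpace 𝓘(ℝ, E) (f x))}
    (hD : IsSmoothSubbundle (F := F) f D) {x₀ : N} {v : TangentSpace 𝓘(ℝ, E) (f x₀)}
    (hv : v ∈ D x₀) :
    ∃ s ∈ 𝓝 x₀, ∃ U : Π x : N, TangentSpace 𝓘(ℝ, E) (f x),
      SmoothAlongOn (F := F) f U s ∧ (∀ x ∈ s, U x ∈ D x) ∧ U x₀ = v := by
  obtain ⟨s, hs, k, b, hb, hbs⟩ := hD x₀
  rw [← (hbs x₀ (mem_of_mem_nhds hs)).2, Submodule.mem_span_range_iff_exists_fun] at hv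
  obtain ⟨c, rfl⟩ := hv
  refine ⟨s, hs, fun y ↦ ∑ i, c i • b i y, SmoothAlongOn.sum hf _ fun i _ ↦
    (hb i).smul hf contMDiffOn_const, fun x hx ↦ ?_, rfl⟩
  rw [← (hbs x hx).2]
  exact Submodule.sum_mem _ fun i _ ↦ Submodule.smul_mem _ _ (Submodule.subset_span ⟨i, rfl⟩)

/-- Multiply by a bump function supported inside `s`. No smoothness of `D` is needed, which permits
its use for the radical. -/
theorem exists_isSection_of_smoothAlongOn [FiniteDimensional ℝ F] [T2Space N]
    [IsManifold 𝓘(ℝ, F) ∞ N] (hf : ContMDiff 𝓘(ℝ, F) 𝓘(ℝ, E) ∞ f)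
    {D : Π x : N, Submodule ℝ (TangentSpace 𝓘(ℝ, E) (f x))} {x₀ : N} (hs : s ∈ 𝓝 x₀)
    {U : Π x : N, TangentSpace 𝓘(ℝ, E) (f x)} (hU : SmoothAlongOn (F := F) f U s)
    (hUD : ∀ x ∈ s, U x ∈ D x) :
    ∃ V : Π x : N, TangentSpace 𝓘(ℝ, E) (f x), IsSection (F := F) f D V ∧ V x₀ = U x₀ := by
  obtain ⟨ρ, -, hρ⟩ := (SmoothBumpFunction.nhds_basis_tsupport (I := 𝓘(ℝ, F)) x₀).mem_iff.1
    (interior_mem_nhds.2 hs)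
  refine ⟨fun y ↦ ρ y • U y, ⟨?_, fun y ↦ ?_⟩, by simp⟩
  · rw [smoothAlongOn_iff hf]
    intro y _
    rw [contMDiffWithinAt_univ]
    by_cases hy : y ∈ tsupport ρ
    · have hys := mem_interior_iff_mem_nhds.1 (hρ hy)
      exact ((smoothAlongOn_iff hf).1 (hU.smul hf ρ.contMDiff.contMDiffOn) y
        (mem_of_mem_nhds hys)).contMDiffAt hys
    · refine (contMDiffAt_const (c := 0)).congr_of_eventuallyEq ?_
      filter_upwards [(isClosed_tsupport ρ).isOpen_compl.mem_nhds hy] with z hz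
      rw [image_eq_zero_of_notMem_tsupport hz, zero_smul, map_zero]
  · by_cases hy : y ∈ tsupport ρ
    · exact Submodule.smul_mem _ _ (hUD y (interior_subset (hρ hy)))
    · simp [image_eq_zero_of_notMem_tsupport hy]

theorem IsSmoothSubbundle.exists_isSection [FiniteDimensional ℝ F] [T2Space N]
    [IsManifold 𝓘(ℝ, F) ∞ N] (hf : ContMDiff 𝓘(ℝ, F) 𝓘(ℝ, E) ∞ f)
    {D : Π x : N, Submodule ℝ (TangentSpace 𝓘(ℝ, E) (f x))}
    (hD : IsSmoothSubbundle (F := F) f D) {x₀ : N} {v : TangentSpace 𝓘(ℝ, E) (f x₀)}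
    (hv : v ∈ D x₀) :
    ∃ V : Π x : N, TangentSpace 𝓘(ℝ, E) (f x), IsSection (F := F) f D V ∧ V x₀ = v := by
  obtain ⟨s, hs, U, hU, hUD, rfl⟩ := hD.exists_smoothAlongOn hf hv
  exact exists_isSection_of_smoothAlongOn hf hs hU hUD

/-- A vector field on `N` is smooth where its image under the differential of an immersion is. -/
theorem smoothAlongOn_id_of_push [FiniteDimensional ℝ E] [FiniteDimensional ℝ F]
    [IsManifold 𝓘(ℝ, F) ∞ N] (hf : ContMDiff 𝓘(ℝ, F) 𝓘(ℝ, E) ∞ f)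
    (himm : ∀ x, Function.Injective (mfderiv 𝓘(ℝ, F) 𝓘(ℝ, E) f x))
    {X : Π x : N, TangentSpace 𝓘(ℝ, F) x} (hX : SmoothAlongOn (E := E) (F := F) f (push f X) s) :
    SmoothAlongOn (E := F) (F := F) id X s := by
  rw [smoothAlongOn_iff contMDiff_id]
  rw [smoothAlongOn_iff hf] at hX
  intro x hx
  have hxs : x ∈ (chartAt F x).source := mem_chart_source F x
  have hfx : f x ∈ (chartAt E (f x)).source := mem_chart_source E (f x)
  let A : N → F →L[ℝ] E :=
    inTangentCoordinates 𝓘(ℝ, F) 𝓘(ℝ, E) id f (mfderiv 𝓘(ℝ, F) 𝓘(ℝ, E) f) x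
  have hA : ContMDiffAt 𝓘(ℝ, F) 𝓘(ℝ, F →L[ℝ] E) ∞ A x := (hf x).mfderiv_const le_rfl
  have hAa (y : N) (a : F) : A y a = coords (f x) (f y)
      (mfderiv 𝓘(ℝ, F) 𝓘(ℝ, E) f y (coordField x a y)) := rfl
  have hAi : Function.Injective (A x) := by
    intro a b hab
    rw [hAa, hAa] at hab
    have h1 := congrArg (fun e ↦ coordField (f x) e (f x)) hab
    simp only [coordField_coords hfx] at h1
    have h2 := congrArg (coords x x) (himm x h1)
    rwa [coords_coordField hxs, coords_coordField hxs] at h2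
  -- A left inverse `ℓ` of `df` at the single point `x` suffices: `B = ℓ ∘ A` is the identity at
  -- `x`, hence invertible nearby, and `X = B⁻¹ ℓ (df X)` there in coordinates.
  obtain ⟨ℓ, hℓ⟩ := (A x).toLinearMap.exists_leftInverse_of_injective (LinearMap.ker_eq_bot.2 hAi)
  let B : N → F →L[ℝ] F := fun y ↦ ℓ.toContinuousLinearMap.comp (A y)
  have hB : ContMDiffAt 𝓘(ℝ, F) 𝓘(ℝ, F →L[ℝ] F) ∞ B x := contMDiffAt_const.clm_comp hA
  have hBx : B x = (ContinuousLinearEquiv.refl ℝ F : F →L[ℝ] F) := by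
    ext a
    exact LinearMap.congr_fun hℓ a
  have hBi : ContMDiffAt 𝓘(ℝ, F) 𝓘(ℝ, F →L[ℝ] F) ∞ (fun y ↦ (B y).inverse) x := by
    refine ContMDiffAt.comp x (g := ContinuousLinearMap.inverse) ?_ hB
    rw [hBx]
    exact (contDiffAt_map_inverse _).contMDiffAt
  have hBe : ∀ᶠ y in 𝓝 x, (B y).IsInvertible := by
    have := hB.continuousAt.eventually (hBx ▸ (ContinuousLinearEquiv.refl ℝ F).nhds)
    filter_upwards [this] with y ⟨e, he⟩ using ⟨e, he⟩
  have hsm : ContMDiffWithinAt 𝓘(ℝ, F) 𝓘(ℝ, F) ∞ (fun y ↦ (B y).inverse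
      (ℓ.toContinuousLinearMap (coords (f x) (f y) (push f X y)))) s x :=
    hBi.contMDiffWithinAt.clm_apply (contMDiffWithinAt_const.clm_apply (hX x hx))
  have heq : (fun y ↦ coords x y (X y)) =ᶠ[𝓝 x] fun y ↦ (B y).inverse
      (ℓ.toContinuousLinearMap (coords (f x) (f y) (push f X y))) := by
    filter_upwards [hBe, chart_source_mem_nhds F x] with y hy hys
    have h1 : ℓ.toContinuousLinearMap (coords (f x) (f y) (push f X y)) =
        B y (coords x y (X y)) := by
      change _ = ℓ.toContinuousLinearMap (A y _)
      rw [hAa, coordField_coords hys]; rfl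
    rw [h1, hy.inverse_apply_self]
  exact hsm.congr_of_eventuallyEq (heq.filter_mono nhdsWithin_le_nhds) heq.self_of_nhds

end Extension

/-! ### Linear algebra of the decomposition under `P` -/

section Main

variable {E : Type*} [NormedAddCommGroup E] [NormedSpace ℝ E]
  {M : Type*} [TopologicalSpace M] [ChartedSpace E M] [IsManifold 𝓘(ℝ, E) ∞ M]
  {F : Type*} [NormedAddCommGroup F] [NormedSpace ℝ F]
  {N : Type*} [TopologicalSpace N] [ChartedSpace F N]
  {g : SemiRiemannianMetric E M} {f : N → M}

namespace TransversalDecomposition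

variable (D : TransversalDecomposition F g f) {x : N}

theorem inner_radical_tangent {r t : TangentSpace 𝓘(ℝ, E) (f x)} (hr : r ∈ radical F g f x)
    (ht : t ∈ tangent (F := F) f x) : g.inner (f x) r t = 0 :=
  hr.2 t ht

theorem radical_le_tangent : radical F g f x ≤ tangent (F := F) f x := inf_le_left

theorem screen_le_tangent : D.screen x ≤ tangent (F := F) f x := D.screen_sup x ▸ le_sup_right

theorem inner_screenTr_tangent {σ t : TangentSpace 𝓘(ℝ, E) (f x)} (hσ : σ ∈ D.screenTr x)
    (ht : t ∈ tangent (F := F) f x) : g.inner (f x) σ t = 0 :=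
  (D.screenTr_sup x ▸ le_sup_right : D.screenTr x ≤ g.perp (tangent (F := F) f x)) hσ t ht

/-- The component in `Rad TN` of a vector of `TM|_N`. -/
def radicalPart (x : N) (v : TangentSpace 𝓘(ℝ, E) (f x)) : TangentSpace 𝓘(ℝ, E) (f x) :=
  (radical F g f x).projection (D.screen x ⊔ D.tr x) (D.isCompl_radical x)
    ((tangent (F := F) f x).projection (D.tr x) (D.isCompl x) v)

theorem exists_decomposition (v : TangentSpace 𝓘(ℝ, E) (f x)) :
    ∃ r ∈ radical F g f x, ∃ s ∈ D.screen x, ∃ l ∈ D.ltr x, ∃ σ ∈ D.screenTr x,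
      v = r + s + (l + σ) := by
  have hv : v ∈ tangent (F := F) f x ⊔ (D.ltr x ⊔ D.screenTr x) := by
    rw [(D.isCompl x).sup_eq_top]; trivial
  obtain ⟨t, ht, n, hn, rfl⟩ := Submodule.mem_sup.1 hv
  obtain ⟨l, hl, σ, hσ, rfl⟩ := Submodule.mem_sup.1 hn
  rw [← D.screen_sup x] at ht
  obtain ⟨r, hr, s, hs, rfl⟩ := Submodule.mem_sup.1 ht
  exact ⟨r, hr, s, hs, l, hl, σ, hσ, rfl⟩

theorem projection_tangent {r s l σ : TangentSpace 𝓘(ℝ, E) (f x)} (hr : r ∈ radical F g f x)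
    (hs : s ∈ D.screen x) (hl : l ∈ D.ltr x) (hσ : σ ∈ D.screenTr x) :
    (tangent (F := F) f x).projection (D.tr x) (D.isCompl x) (r + s + (l + σ)) = r + s := by
  have h : IsCompl (tangent (F := F) f x) (D.tr x) := D.isCompl x
  rw [map_add, Submodule.projection_apply_of_mem_left h (D.screen_sup x ▸
    Submodule.add_mem_sup hr hs), Submodule.projection_apply_of_mem_right h
    (Submodule.add_mem_sup hl hσ), add_zero]

theorem radicalPart_eq {r s l σ : TangentSpace 𝓘(ℝ, E) (f x)} (hr : r ∈ radical F g f x)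
    (hs : s ∈ D.screen x) (hl : l ∈ D.ltr x) (hσ : σ ∈ D.screenTr x) :
    D.radicalPart x (r + s + (l + σ)) = r := by
  rw [radicalPart, D.projection_tangent hr hs hl hσ, map_add,
    Submodule.projection_apply_of_mem_left _ hr,
    Submodule.projection_apply_of_mem_right _ (Submodule.mem_sup_left hs), add_zero]

theorem inner_radical_decomposition {u r s l σ : TangentSpace 𝓘(ℝ, E) (f x)}
    (hu : u ∈ radical F g f x) (hr : r ∈ radical F g f x)
    (hs : s ∈ D.screen x) (hσ : σ ∈ D.screenTr x) :
    g.inner (f x) u (r + s + (l + σ)) = g.inner (f x) u l := by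
  rw [map_add, map_add, map_add, inner_radical_tangent hu (radical_le_tangent hr),
    inner_radical_tangent hu (D.screen_le_tangent hs), g.symm _ u σ,
    D.inner_screenTr_tangent hσ (radical_le_tangent hu)]
  simp

theorem inner_decomposition_screen {r s l σ z : TangentSpace 𝓘(ℝ, E) (f x)}
    (hr : r ∈ radical F g f x) (hl : l ∈ D.ltr x) (hσ : σ ∈ D.screenTr x) (hz : z ∈ D.screen x) :
    g.inner (f x) (r + s + (l + σ)) z = g.inner (f x) s z := by
  simp only [map_add, add_apply]
  rw [inner_radical_tangent hr (D.screen_le_tangent hz), D.ltr_perp_screen x hl z hz,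
    D.inner_screenTr_tangent hσ (D.screen_le_tangent hz)]
  simp

/-- Radical vectors are orthogonal to every other summand of `TM|_N`, so `ltr(TN)` alone detects
them. -/
theorem eq_zero_of_radical_perp_ltr {r : TangentSpace 𝓘(ℝ, E) (f x)} (hr : r ∈ radical F g f x)
    (h : ∀ l ∈ D.ltr x, g.inner (f x) r l = 0) : r = 0 := by
  refine g.nondegenerate _ _ fun v ↦ ?_
  obtain ⟨r', hr', s, hs, l, hl, σ, hσ, rfl⟩ := D.exists_decomposition v
  rw [D.inner_radical_decomposition hr hr' hs hσ, h l hl]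

theorem eq_zero_of_screen_perp_screen {s : TangentSpace 𝓘(ℝ, E) (f x)} (hs : s ∈ D.screen x)
    (h : ∀ z ∈ D.screen x, g.inner (f x) s z = 0) : s = 0 := by
  refine g.nondegenerate _ _ fun v ↦ ?_
  obtain ⟨r', hr', z, hz, l, hl, σ, hσ, rfl⟩ := D.exists_decomposition v
  rw [g.symm, D.inner_decomposition_screen hr' hl hσ hs, g.symm, h z hz]

/-- The tangential part of `v` is radical iff `v` is orthogonal to the screen distribution. -/
theorem projection_mem_radical_iff (v : TangentSpace 𝓘(ℝ, E) (f x)) :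
    (tangent (F := F) f x).projection (D.tr x) (D.isCompl x) v ∈ radical F g f x ↔
      ∀ z ∈ D.screen x, g.inner (f x) v z = 0 := by
  obtain ⟨r, hr, s, hs, l, hl, σ, hσ, rfl⟩ := D.exists_decomposition v
  rw [D.projection_tangent hr hs hl hσ]
  constructor
  · intro h z hz
    rw [D.inner_decomposition_screen hr hl hσ hz]
    have := inner_radical_tangent h (D.screen_le_tangent hz)
    rwa [map_add, add_apply, inner_radical_tangent hr (D.screen_le_tangent hz), zero_add] at this
  · intro h
    rw [D.eq_zero_of_screen_perp_screen hs fun z hz ↦ by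
      rw [← D.inner_decomposition_screen hr hl hσ hz, h z hz], add_zero]
    exact hr

namespace IsRadicalTransversal

variable {D} {P : GoldenStructure g}

theorem golden_mem_ltr (hD : D.IsRadicalTransversal P)
    {r : TangentSpace 𝓘(ℝ, E) (f x)} (hr : r ∈ radical F g f x) :
    P.P (f x) r ∈ D.ltr x :=
  hD.map_radical x ▸ Submodule.mem_map_of_mem hr

theorem golden_mem_screen (hD : D.IsRadicalTransversal P)
    {s : TangentSpace 𝓘(ℝ, E) (f x)} (hs : s ∈ D.screen x) :
    P.P (f x) s ∈ D.screen x :=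
  hD.map_screen x ▸ Submodule.mem_map_of_mem hs

theorem exists_golden_eq (hD : D.IsRadicalTransversal P)
    {l : TangentSpace 𝓘(ℝ, E) (f x)} (hl : l ∈ D.ltr x) :
    ∃ r ∈ radical F g f x, P.P (f x) r = l := by
  rw [← hD.map_radical x] at hl
  exact hl

/-- Since `ltr(TN) = P(Rad TN)` and `P` is self-adjoint, the duality of `Rad TN` and `ltr(TN)`
becomes nondegeneracy of `g(u, P r)` on `Rad TN`. -/
theorem eq_zero_of_perp_golden (hD : D.IsRadicalTransversal P)
    {r : TangentSpace 𝓘(ℝ, E) (f x)} (hr : r ∈ radical F g f x)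
    (h : ∀ u ∈ radical F g f x, g.inner (f x) u (P.P (f x) r) = 0) : r = 0 := by
  refine D.eq_zero_of_radical_perp_ltr hr fun l hl ↦ ?_
  obtain ⟨u, hu, rfl⟩ := hD.exists_golden_eq hl
  rw [g.symm, P.compatible, h u hu]

/-- Self-adjointness puts `P σ` in `TN^⊥`. Its radical part pairs to zero with each `P u` in
`ltr(TN)`, because `g(P σ, P u) = g(σ, P u + u) = 0`. -/
theorem golden_mem_screenTr (hD : D.IsRadicalTransversal P)
    {σ : TangentSpace 𝓘(ℝ, E) (f x)} (hσ : σ ∈ D.screenTr x) :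
    P.P (f x) σ ∈ D.screenTr x := by
  have h1 : P.P (f x) σ ∈ g.perp (tangent (F := F) f x) := by
    intro t ht
    rw [← D.screen_sup x] at ht
    obtain ⟨r, hr, s, hs, rfl⟩ := Submodule.mem_sup.1 ht
    rw [P.compatible, map_add, map_add, g.symm _ σ (P.P (f x) r),
      D.ltr_perp_screenTr x (hD.golden_mem_ltr hr) σ hσ,
      D.inner_screenTr_tangent hσ (D.screen_le_tangent (hD.golden_mem_screen hs)), add_zero]
  rw [← D.screenTr_sup x] at h1
  obtain ⟨ρ, hρ, τ, hτ, h2⟩ := Submodule.mem_sup.1 h1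
  have h3 : ρ = 0 := by
    refine D.eq_zero_of_radical_perp_ltr hρ fun l hl ↦ ?_
    obtain ⟨u, hu, rfl⟩ := hD.exists_golden_eq hl
    have h4 : ρ = P.P (f x) σ - τ := eq_sub_of_add_eq h2
    rw [h4, map_sub, sub_apply, P.compatible, P.sq, map_add, g.symm _ σ (P.P (f x) u),
      g.symm _ τ (P.P (f x) u), D.ltr_perp_screenTr x hl σ hσ, D.ltr_perp_screenTr x hl τ hτ,
      D.inner_screenTr_tangent hσ (radical_le_tangent hu)]
    simp
  rw [← h2, h3, zero_add]
  exact hτ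

/-- `P` moves the radical coordinates `(r, r')` of `v` to `(r', r + r')`: the first is the radical
part, the second is what radical vectors see. -/
theorem exists_decomposition (hD : D.IsRadicalTransversal P)
    (v : TangentSpace 𝓘(ℝ, E) (f x)) :
    ∃ r ∈ radical F g f x, ∃ r' ∈ radical F g f x,
      (D.radicalPart x v = r ∧ ∀ u ∈ radical F g f x,
        g.inner (f x) u v = g.inner (f x) u (P.P (f x) r')) ∧
      (D.radicalPart x (P.P (f x) v) = r' ∧ ∀ u ∈ radical F g f x,
        g.inner (f x) u (P.P (f x) v) = g.inner (f x) u (P.P (f x) (r + r'))) := by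
  obtain ⟨r, hr, s, hs, l, hl, σ, hσ, rfl⟩ := D.exists_decomposition v
  obtain ⟨r', hr', rfl⟩ := hD.exists_golden_eq hl
  have hPv : P.P (f x) (r + s + (P.P (f x) r' + σ)) =
      r' + P.P (f x) s + (P.P (f x) (r + r') + P.P (f x) σ) := by
    simp only [map_add, P.sq]; abel
  have hl' := hD.golden_mem_ltr (add_mem hr hr')
  rw [hPv]
  exact ⟨r, hr, r', hr', ⟨D.radicalPart_eq hr hs hl hσ,
    fun u hu ↦ D.inner_radical_decomposition hu hr hs hσ⟩,
    D.radicalPart_eq hr' (hD.golden_mem_screen hs) hl' (hD.golden_mem_screenTr hσ),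
    fun u hu ↦ D.inner_radical_decomposition hu hr' (hD.golden_mem_screen hs)
      (hD.golden_mem_screenTr hσ)⟩

/-- If `v` and `P v` are orthogonal to `Rad TN`, their components in `Rad TN` vanish. -/
theorem radicalPart_eq_zero (hD : D.IsRadicalTransversal P)
    {v : TangentSpace 𝓘(ℝ, E) (f x)}
    (h : ∀ u ∈ radical F g f x, g.inner (f x) u v = 0)
    (hP : ∀ u ∈ radical F g f x, g.inner (f x) u (P.P (f x) v) = 0) :
    D.radicalPart x v = 0 ∧ D.radicalPart x (P.P (f x) v) = 0 := by
  obtain ⟨r, hr, r', hr', ⟨h1, h2⟩, h3, h4⟩ := hD.exists_decomposition v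
  have h5 := hD.eq_zero_of_perp_golden hr' fun u hu ↦ by rw [← h2 u hu, h u hu]
  have h6 := hD.eq_zero_of_perp_golden (add_mem hr hr') fun u hu ↦ by rw [← h4 u hu, hP u hu]
  subst h5
  rw [add_zero] at h6
  exact ⟨h1.trans h6, h3⟩

/-- If `v`, `P v` and `P² v` have the same component in `Rad TN`, then `v` is orthogonal to
`Rad TN`. -/
theorem inner_radical_eq_zero (hD : D.IsRadicalTransversal P)
    {v : TangentSpace 𝓘(ℝ, E) (f x)}
    (h : D.radicalPart x (P.P (f x) v) = D.radicalPart x v)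
    (hP : D.radicalPart x (P.P (f x) (P.P (f x) v)) = D.radicalPart x (P.P (f x) v))
    {u : TangentSpace 𝓘(ℝ, E) (f x)} (hu : u ∈ radical F g f x) : g.inner (f x) u v = 0 := by
  obtain ⟨r, hr, r', hr', ⟨h1, h2⟩, h3, h4⟩ := hD.exists_decomposition v
  have h5 : D.radicalPart x (P.P (f x) (P.P (f x) v)) =
      D.radicalPart x (P.P (f x) v) + D.radicalPart x v := by
    rw [P.sq]; simp only [radicalPart, map_add]
  rw [h5, add_eq_left] at hP
  rw [hP] at h
  rw [h2 u hu, ← h3, h, map_zero, map_zero]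

/-- No smooth frame of `Rad TN` is given, but `P² = P + I` makes `P - I` the inverse of `P`, so `P -
I` carries smooth sections of `ltr(TN)` to smooth radical ones. -/
theorem exists_isTangentSection (hD : D.IsRadicalTransversal P)
    [FiniteDimensional ℝ E] [FiniteDimensional ℝ F] [T2Space N]
    [IsManifold 𝓘(ℝ, F) ∞ N] (hf : ContMDiff 𝓘(ℝ, F) 𝓘(ℝ, E) ∞ f)
    (himm : ∀ x, Function.Injective (mfderiv 𝓘(ℝ, F) 𝓘(ℝ, E) f x))
    {u : TangentSpace 𝓘(ℝ, E) (f x)} (hu : u ∈ radical F g f x) :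
    ∃ Y : Π x : N, TangentSpace 𝓘(ℝ, F) x,
      IsTangentSection f (radical F g f) Y ∧ push f Y x = u := by
  obtain ⟨s, hs, B, hB, hBl, hBx⟩ :=
    D.ltr_smooth.exists_smoothAlongOn hf (hD.golden_mem_ltr hu)
  have hU : SmoothAlongOn (F := F) f (fun y ↦ P.P (f y) (B y) + (-1 : ℝ) • B y) s :=
    (P.smoothAlongOn hf.contMDiffOn hB).add hf (hB.smul hf contMDiffOn_const)
  have hUr : ∀ y ∈ s, P.P (f y) (B y) + (-1 : ℝ) • B y ∈ radical F g f y := by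
    intro y hy
    obtain ⟨r, hr, h⟩ := hD.exists_golden_eq (hBl y hy)
    rw [← h, P.sq]
    convert hr using 1
    module
  -- The value outside `s` is immaterial: the bump function removes it.
  have hX : ∀ y, ∃ X : TangentSpace 𝓘(ℝ, F) y, y ∈ s →
      mfderiv 𝓘(ℝ, F) 𝓘(ℝ, E) f y X = P.P (f y) (B y) + (-1 : ℝ) • B y := by
    intro y
    by_cases hy : y ∈ s
    · obtain ⟨X, hX⟩ := (hUr y hy).1
      exact ⟨X, fun _ ↦ hX⟩
    · exact ⟨0, fun h ↦ absurd h hy⟩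
  choose X hX using hX
  have hpX : SmoothAlongOn (E := E) (F := F) f (push f X) s :=
    ContMDiffOn.congr hU fun y hy ↦ by rw [push, hX y hy]
  obtain ⟨Y, ⟨hY, hYr⟩, hYx⟩ := exists_isSection_of_smoothAlongOn contMDiff_id
    (D := fun y ↦ (radical F g f y).comap (mfderiv 𝓘(ℝ, F) 𝓘(ℝ, E) f y).toLinearMap) hs
    (smoothAlongOn_id_of_push hf himm hpX) fun y hy ↦ by
      have := hUr y hy
      rw [← hX y hy] at this
      exact this
  refine ⟨Y, ⟨contMDiffOn_univ.1 hY, hYr⟩, ?_⟩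
  refine (congrArg (mfderiv 𝓘(ℝ, F) 𝓘(ℝ, E) f x) hYx).trans ?_
  refine (hX x (mem_of_mem_nhds hs)).trans ?_
  rw [hBx, P.sq]
  module

end IsRadicalTransversal

end TransversalDecomposition

/-- Differentiate the vanishing function `g(U, V)`: the two terms are opposite. -/
theorem IsLeviCivita.inner_covAlong_eq_zero_iff [FiniteDimensional ℝ E]
    {cov : CovariantDerivative 𝓘(ℝ, E) E (TangentSpace 𝓘(ℝ, E) : M → Type _)}
    (hcov : IsLeviCivita g cov) {U V : Π x : N, TangentSpace 𝓘(ℝ, E) (f x)}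
    (hU : SmoothAlongOn (F := F) f U Set.univ) (hV : SmoothAlongOn (F := F) f V Set.univ)
    (hUV : ∀ y, g.inner (f y) (U y) (V y) = 0) (x : N) (w : TangentSpace 𝓘(ℝ, F) x) :
    g.inner (f x) (covAlong cov f U x w) (V x) = 0 ↔
      g.inner (f x) (U x) (covAlong cov f V x w) = 0 := by
  have h := hcov.mvfderiv_inner (hU.differentiableAlongAt x) (hV.differentiableAlongAt x) w
  simp only [hUV, mvfderiv_const, zero_apply] at h
  constructor <;> intro h' <;> linarith

end Main

end GoldenLightlike

end

theorem mainTheorem7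
    {E : Type*} [NormedAddCommGroup E] [NormedSpace ℝ E] [FiniteDimensional ℝ E]
    {M : Type*} [TopologicalSpace M] [T2Space M] [SecondCountableTopology M]
    [ChartedSpace E M] [IsManifold 𝓘(ℝ, E) ∞ M]
    {F : Type*} [NormedAddCommGroup F] [NormedSpace ℝ F] [FiniteDimensional ℝ F]
    {N : Type*} [TopologicalSpace N] [T2Space N] [SecondCountableTopology N]
    [ChartedSpace F N] [IsManifold 𝓘(ℝ, F) ∞ N]
    (g : SemiRiemannianMetric E M) (P : GoldenStructure g)
    (cov : CovariantDerivative 𝓘(ℝ, E) E (TangentSpace 𝓘(ℝ, E) : M → Type _))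
    (hcov : IsLeviCivita g cov) (hP : P.IsLocallyGolden cov)
    (f : N → M) (r : ℕ) (hN : IsLightlikeSubmanifold F g f r)
    (D : TransversalDecomposition F g f) (hD : D.IsRadicalTransversal P) :
    D.RadicalDefinesTotallyGeodesicFoliation cov ↔
      ∀ (W : Π x : N, TangentSpace 𝓘(ℝ, F) x) (Z : Π x : N, TangentSpace 𝓘(ℝ, E) (f x)),
        IsTangentSection f (radical F g f) W → IsSection (F := F) f D.screen Z →
          ∀ x, D.hStar cov W (fun y ↦ P.P (f y) (Z y)) x = D.hStar cov W Z x := by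
  have hf := hN.contMDiff
  have hcomplete : CompleteSpace F := FiniteDimensional.complete ℝ F
  have hPZ {Z : Π x : N, TangentSpace 𝓘(ℝ, E) (f x)} (hZ : IsSection (F := F) f D.screen Z) :
      IsSection (F := F) f D.screen (fun y ↦ P.P (f y) (Z y)) :=
    ⟨P.smoothAlongOn hf.contMDiffOn hZ.1, fun x ↦ hD.golden_mem_screen (hZ.2 x)⟩
  have hcovP {Z : Π x : N, TangentSpace 𝓘(ℝ, E) (f x)} (hZ : IsSection (F := F) f D.screen Z)
      (x : N) (w : TangentSpace 𝓘(ℝ, F) x) :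
      covAlong cov f (fun y ↦ P.P (f y) (Z y)) x w = P.P (f x) (covAlong cov f Z x w) :=
    hP.covAlong hcov (hZ.1.differentiableAlongAt x) w
  have hiff {Y : Π x : N, TangentSpace 𝓘(ℝ, F) x} {Z : Π x : N, TangentSpace 𝓘(ℝ, E) (f x)}
      (hY : IsTangentSection f (radical F g f) Y) (hZ : IsSection (F := F) f D.screen Z) (x : N)
      (w : TangentSpace 𝓘(ℝ, F) x) :
      g.inner (f x) (covAlong cov f (push f Y) x w) (Z x) = 0 ↔
        g.inner (f x) (push f Y x) (covAlong cov f Z x w) = 0 :=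
    hcov.inner_covAlong_eq_zero_iff (smoothAlongOn_push hf hY.1) hZ.1
      (fun y ↦ TransversalDecomposition.inner_radical_tangent (hY.2 y)
        (D.screen_le_tangent (hZ.2 y))) x w
  constructor
  · intro H W Z hW hZ x
    have key {Z : Π x : N, TangentSpace 𝓘(ℝ, E) (f x)} (hZ : IsSection (F := F) f D.screen Z)
        (u : TangentSpace 𝓘(ℝ, E) (f x)) (hu : u ∈ radical F g f x) :
        g.inner (f x) u (covAlong cov f Z x (W x)) = 0 := by
      obtain ⟨Y, hY, rfl⟩ := hD.exists_isTangentSection hf hN.immersion hu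
      exact (hiff hY hZ x (W x)).1
        ((D.projection_mem_radical_iff _).1 ((H W Y hW hY).2 x) _ (hZ.2 x))
    -- Orthogonality for `Z` alone only kills `h*(W, P Z)`; using `P Z` as well kills `h*(W, Z)`.
    have h := key (hPZ hZ)
    rw [hcovP hZ] at h
    obtain ⟨h1, h2⟩ := hD.radicalPart_eq_zero (key hZ) h
    rw [← hcovP hZ] at h2
    exact h2.trans h1.symm
  · intro H
    have key {X Y : Π x : N, TangentSpace 𝓘(ℝ, F) x}
        (hX : IsTangentSection f (radical F g f) X) (hY : IsTangentSection f (radical F g f) Y)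
        (x : N) : ∀ z ∈ D.screen x,
        g.inner (f x) (covAlong cov f (push f Y) x (X x)) z = 0 := by
      intro z hz
      obtain ⟨Z, hZ, rfl⟩ := D.screen_smooth.exists_isSection hf hz
      -- `hStar` is by definition the `radicalPart` of the ambient derivative. The hypothesis is
      -- used for `Z` and again for `P Z`, which brings in `P²`.
      have h1 : D.radicalPart x _ = D.radicalPart x _ := H X Z hX hZ x
      have h2 : D.radicalPart x _ = D.radicalPart x _ := H X _ hX (hPZ hZ) x
      rw [hcovP (hPZ hZ), hcovP hZ] at h2
      rw [hcovP hZ] at h1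
      exact (hiff hY hZ x (X x)).2 (hD.inner_radical_eq_zero h1 h2 (hY.2 x))
    intro X Y hX hY
    refine ⟨fun x ↦ ?_, fun x ↦ (D.projection_mem_radical_iff _).2 (key hX hY x)⟩
    -- The bracket is tangent, hence its own tangential projection, so the orthogonality criterion
    -- applies to it.
    have h1 : push (E := E) f (VectorField.mlieBracket 𝓘(ℝ, F) X Y) x ∈ tangent (F := F) f x := ⟨_, rfl⟩
    have h2 : IsCompl (tangent (F := F) f x) (D.tr x) := D.isCompl x
    rw [← Submodule.projection_apply_of_mem_left h2 h1, D.projection_mem_radical_iff,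
      ← hcov.covAlong_push_sub hf hX.1 hY.1 x]
    intro z hz
    rw [map_sub, sub_apply, key hX hY x z hz, key hY hX x z hz, sub_zero]
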